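/- Let $n\ge 2$ be an integer, and let $\mathcal H(n,\mathbb C)$ be the group, under composition, of all maps $f:\mathbb C^n\to\mathbb C^n$ of the form $f(z)=\lambda z+a$ with $\lambda\in\mathbb C\setminus\{0\}$ and $a\in\mathbb C^n$. Let $G$ be a non-abelian subgroup of $\mathcal H(n,\mathbb C)$ that is generated, as a group, by $n-2$ affine maps $f_1,\dots,f_{n-2}$ (not necessarily distinct). Then $G$ has no dense orbit in $\mathbb C^n$: for every $z\in\mathbb C^n$, the orbit $G(z)=\{f(z): f\in G\}$ is not dense in $\mathbb C^n$. -/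

import Mathlib

/-- The group `𝓗(n, ℂ)` generated by the affine homotheties of `ℂⁿ`: all maps
`z ↦ c z + a` with `c ∈ ℂ \ {0}` and `a ∈ ℂⁿ`, as a subgroup of the group of affine
automorphisms of `ℂⁿ` under composition. -/
def homothetyGroup (n : ℕ) :
    Subgroup (EuclideanSpace ℂ (Fin n) ≃ᵃ[ℂ] EuclideanSpace ℂ (Fin n)) where
  carrier := {f | ∃ (c : ℂ) (a : EuclideanSpace ℂ (Fin n)), c ≠ 0 ∧ ∀ z, f z = c • z + a}
  one_mem' := ⟨1, 0, one_ne_zero, fun z => by simp⟩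
  mul_mem' := by
    rintro f g ⟨c, a, hc, hf⟩ ⟨d, b, hd, hg⟩
    refine ⟨c * d, c • b + a, mul_ne_zero hc hd, fun z => ?_⟩
    rw [AffineEquiv.mul_def, AffineEquiv.trans_apply, hg, hf, smul_add, smul_smul, add_assoc]
  inv_mem' := by
    rintro f ⟨c, a, hc, hf⟩
    refine ⟨c⁻¹, -(c⁻¹ • a), inv_ne_zero hc, fun z => ?_⟩
    rw [AffineEquiv.inv_def]
    apply f.injective
    rw [AffineEquiv.apply_symm_apply, hf, smul_add, smul_smul, mul_inv_cancel₀ hc, smul_neg,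
      smul_smul, mul_inv_cancel₀ hc, one_smul, one_smul, neg_add_cancel_right]

/-- The orbit `G(z) = {f(z) : f ∈ G}` of a point `z ∈ ℂⁿ` under a group `G` of affine
automorphisms of `ℂⁿ`. -/
def groupOrbit {n : ℕ}
    (G : Subgroup (EuclideanSpace ℂ (Fin n) ≃ᵃ[ℂ] EuclideanSpace ℂ (Fin n)))
    (z : EuclideanSpace ℂ (Fin n)) : Set (EuclideanSpace ℂ (Fin n)) :=
  {w | ∃ f ∈ G, f z = w}

/-- A linear subspace containing the translation vector of a homothety is invariant under the
homothety and its inverse. -/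
theorem homothety_apply_mem_iff {K V : Type*} [Field K] [AddCommGroup V] [Module K V]
    (S : Submodule K V) {c : K} (hc : c ≠ 0) {a : V} (ha : a ∈ S) (w : V) :
    c • w + a ∈ S ↔ w ∈ S := by
  rw [S.add_mem_iff_left ha, S.smul_mem_iff hc]

/-- If `S` is invariant, together with its complement, under every map of a set, then it is
invariant under the group generated by that set. -/
theorem apply_mem_iff_of_mem_closure {K V : Type*} [Field K] [AddCommGroup V] [Module K V]
    (S : Set V) {T : Set (V ≃ᵃ[K] V)} (hT : ∀ f ∈ T, ∀ w, f w ∈ S ↔ w ∈ S)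
    {f : V ≃ᵃ[K] V} (hf : f ∈ Subgroup.closure T) (w : V) : f w ∈ S ↔ w ∈ S := by
  induction hf using Subgroup.closure_induction generalizing w with
  | mem f hf => exact hT f hf w
  | one => rfl
  | mul f g _ _ hf hg => exact (hf (g w)).trans (hg w)
  | inv f _ hf =>
    rw [← hf (f⁻¹ w), AffineEquiv.inv_def, AffineEquiv.apply_symm_apply]

/-- A proper linear subspace of a finite-dimensional normed space contains no dense set. -/
theorem not_dense_of_subset_submodule {V : Type*} [NormedAddCommGroup V] [NormedSpace ℂ V]
    [FiniteDimensional ℂ V] {S : Submodule ℂ V} (hS : S ≠ ⊤) {A : Set V} (hA : A ⊆ S) :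
    ¬ Dense A := fun hd =>
  hS <| SetLike.coe_injective <|
    S.closed_of_finiteDimensional.closure_eq.symm.trans (hd.mono hA).closure_eq

theorem corollary1p6 (n m : ℕ) (hm : m + 2 = n)
    (G : Subgroup (EuclideanSpace ℂ (Fin n) ≃ᵃ[ℂ] EuclideanSpace ℂ (Fin n)))
    (hG : G ≤ homothetyGroup n)
    (hnonab : ∃ f ∈ G, ∃ g ∈ G, f * g ≠ g * f)
    (F : Fin m → (EuclideanSpace ℂ (Fin n) ≃ᵃ[ℂ] EuclideanSpace ℂ (Fin n)))
    (hgen : G = Subgroup.closure (Set.range F)) :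
    ¬ ∃ z : EuclideanSpace ℂ (Fin n), Dense (groupOrbit G z) := by
  rintro ⟨z, hz⟩
  have hF : ∀ i, F i ∈ homothetyGroup n := fun i =>
    hG (hgen ▸ Subgroup.subset_closure (Set.mem_range_self i))
  choose c a hc hF using hF
  let v : Fin (m + 1) → EuclideanSpace ℂ (Fin n) := Fin.cons z a
  let S := Submodule.span ℂ (Set.range v)
  have hzS : z ∈ S := Submodule.subset_span ⟨0, rfl⟩
  have haS : ∀ i, a i ∈ S := fun i => Submodule.subset_span ⟨i.succ, by simp [v]⟩
  -- `v` lists `m + 1 = n - 1` vectors, one fewer than the dimension.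
  have hS : S ≠ ⊤ := by
    intro h
    have hle : Module.finrank ℂ S ≤ m + 1 := by
      simpa [Set.finrank] using finrank_range_le_card (R := ℂ) v
    rw [h, finrank_top, finrank_euclideanSpace_fin] at hle
    omega
  refine not_dense_of_subset_submodule hS ?_ hz
  rintro _ ⟨f, hf, rfl⟩
  rw [hgen] at hf
  -- Invariance stated as an equivalence passes to inverses, so checking generators suffices.
  refine (apply_mem_iff_of_mem_closure (S : Set _) ?_ hf z).2 hzS
  rintro _ ⟨i, rfl⟩ w
  rw [hF]
  exact homothety_apply_mem_iff S (hc i) (haS i) w
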